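/- Throughout, $R$ is an associative ring with unity, $M$ is a unitary right $R$-module and $S=\operatorname{End}_R(M)$. For right $R$-modules $A,B$: $A$ is *Rickart* if $\ker\varphi$ is a direct summand of $A$ for every $\varphi\in\operatorname{End}_R(A)$; $A$ is *$B$-Rickart* if $\ker\rho$ is a direct summand of $A$ for every $\rho\in\operatorname{Hom}_R(A,B)$; $A$ is *endoregular* if $\operatorname{End}_R(A)$ is von Neumann regular; $A$ is *$B$-injective* if every homomorphism from a submodule of $B$ to $A$ extends to $B$; indecomposable modules are nonzero. A ring is *semiprimary* if its Jacobson radical is nilpotent with semisimple artinian quotient. A ring $T$ is a *piecewise domain* (PWD) if it has a complete set $\{e_1,\dots,e_m\}$ of orthogonal idempotents such that $xy=0$ implies $x=0$ or $y=0$ whenever $x\in e_iTe_k$ and $y\in e_kTe_j$. **Theorem.** Let $n\ge 0$ and $\ell_1,\dots,\ell_n\ge 1$ be integers. The following are equivalent. (a) $M\cong\bigoplus_{i=1}^n H_i^{(\ell_i)}$, where each $H_i$ is an indecomposable endoregular module, $H_i$ is $H_j$-Rickart for all $1\le i,j\le n$, and $H_i\not\cong H_j$ for $i\ne j$. (b)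 After a permutation of the sequence $(\ell_1,\dots,\ell_n)$, the ring $S$ is isomorphic to an upper triangular matrix ring $$\begin{pmatrix}\operatorname{Mat}_{\ell_1}(D_1)&V_{12}&\cdots&V_{1n}\\0&\operatorname{Mat}_{\ell_2}(D_2)&\cdots&V_{2n}\\\vdots&\vdots&\ddots&\vdots\\0&0&\cdots&\operatorname{Mat}_{\ell_n}(D_n)\end{pmatrix},$$ where each $D_i$ is a division ring and $V_{ij}$ is a $\operatorname{Mat}_{\ell_i}(D_i)$-$\operatorname{Mat}_{\ell_j}(D_j)$-bimodule for $i<j$ (the ring multiplication using associative balanced bimodule products $V_{ij}\times V_{jk}\to V_{ik}$), such that the following annihilator condition holds: for all $i<j$ and every idempotent $\varepsilon\in S$ that corresponds to a diagonal matrix unit of $\operatorname{Mat}_{\ell_j}(D_j)$, with $H_j=\varepsilon M$, $$\{\varphi\in S:\varphi(x)=0\}\cap V_{ij}\,\varepsilon=0\qquad\text{for every }0\ne x\in H_j ;$$ that is, the restriction to $H_j$ of an element of $V_{ij}$ is zero or injective. In particular, if these conditions hold for some $n$ and $\ell_1,\dots,\ell_n$, then $S$ is a semiprimary PWD. **Corollary.**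 Suppose $M\cong\bigoplus_{i=1}^n H_i$, where each $H_i$ is an indecomposable endoregular module, $H_i$ is $H_j$-Rickart for all $i,j$, and $H_i\not\cong H_j$ for $i\ne j$. If the $H_i$ can be ordered so that $H_i$ is $H_j$-injective for all $i<j$, then $M$ is a Rickart module, and $S$ is isomorphic to an upper triangular matrix ring with division rings $D_1,\dots,D_n$ on the diagonal and $D_i$-$D_j$-bimodules $V_{ij}$ in the positions $i<j$. In particular, $S$ is a semiprimary PWD. -/

import Mathlib

universe u v w

/-! ### Rickart and endoregular modules -/

section Modules

variable (R : Type u) [Ring R]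

/-- `M` is `N`-Rickart: the kernel of every homomorphism `M → N` is a direct summand of `M`. -/
def IsRelRickart (M : Type v) [AddCommGroup M] [Module R M]
    (N : Type w) [AddCommGroup N] [Module R N] : Prop :=
  ∀ f : M →ₗ[R] N, IsComplemented (LinearMap.ker f)

/-- `M` is Rickart: the kernel of every endomorphism of `M` is a direct summand of `M`. -/
def IsRickart (M : Type v) [AddCommGroup M] [Module R M] : Prop :=
  ∀ f : Module.End R M, IsComplemented (LinearMap.ker f)

/-- A ring is von Neumann regular if every `a` can be written as `a = a x a`. -/
def IsVonNeumannRegular (S : Type v) [Ring S] : Prop :=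
  ∀ a : S, ∃ x : S, a * x * a = a

/-- `M` is endoregular: its endomorphism ring is von Neumann regular. -/
def IsEndoregular (M : Type v) [AddCommGroup M] [Module R M] : Prop :=
  IsVonNeumannRegular (Module.End R M)

/-- `M` is indecomposable: it is nonzero, and in every decomposition `M = N ⊕ N'` one of
the two summands is zero. -/
def IsIndecomposableModule (M : Type v) [AddCommGroup M] [Module R M] : Prop :=
  Nontrivial M ∧ ∀ N N' : Submodule R M, IsCompl N N' → N = ⊥ ∨ N' = ⊥

/-- `M` is `N`-injective: every homomorphism from a submodule of `N` to `M` extends to `N`. -/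
def IsRelInjective (M : Type v) [AddCommGroup M] [Module R M]
    (N : Type w) [AddCommGroup N] [Module R N] : Prop :=
  ∀ (K : Submodule R N) (f : K →ₗ[R] M), ∃ g : N →ₗ[R] M, ∀ x : K, g x = f x

/-- A finite family of pairwise non-isomorphic indecomposable endoregular modules each of which
is Rickart relative to every one of them. -/
structure IsRickartFamily {n : ℕ} (H : Fin n → Type v) [∀ i, AddCommGroup (H i)]
    [∀ i, Module R (H i)] : Prop where
  indecomposable : ∀ i, IsIndecomposableModule R (H i)
  endoregular : ∀ i, IsEndoregular R (H i)
  relRickart : ∀ i j, IsRelRickart R (H i) (H j)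
  not_iso : ∀ i j, i ≠ j → IsEmpty (H i ≃ₗ[R] H j)

/-- `M` is isomorphic to `⨁ i, H i ^ (ℓ i)` for a family `H` of pairwise non-isomorphic
indecomposable endoregular modules that are mutually relatively Rickart.
(Direct sums over finite index sets are written as products.) -/
def HasRickartDecomposition (M : Type v) [AddCommGroup M] [Module R M]
    {n : ℕ} (ℓ : Fin n → ℕ) : Prop :=
  ∃ (H : Fin n → Type v) (_ : ∀ i, AddCommGroup (H i)) (_ : ∀ i, Module R (H i)),
    IsRickartFamily R H ∧ Nonempty (M ≃ₗ[R] (∀ i, Fin (ℓ i) → H i))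

end Modules

/-- A ring `S` is a piecewise domain: it has a complete set of orthogonal idempotents
`e₁, …, e_m` such that, for `x ∈ eᵢ S eₖ` and `y ∈ eₖ S eⱼ`, `x y = 0` implies
`x = 0` or `y = 0`. -/
def IsPiecewiseDomain (S : Type v) [Ring S] : Prop :=
  ∃ (m : ℕ) (e : Fin m → S), CompleteOrthogonalIdempotents e ∧
    ∀ (i k j : Fin m) (x y : S), e i * x * e k = x → e k * y * e j = y →
      x * y = 0 → x = 0 ∨ y = 0

/-! ### Upper triangular matrix rings with bimodule entries -/

/-- The data of an upper triangular matrix ring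
```
A₁  V₁₂ … V₁ₙ
0   A₂  … V₂ₙ
⋮           ⋮
0   0   … Aₙ
```
with rings `Aᵢ` on the diagonal: abelian groups `V i j` with associative unital biadditive
products `V i j × V j k → V i k`, where the ring `V i i` is identified with `A i` and `V i j = 0`
for `j < i`. The products `V i i × V i j → V i j` and `V i j × V j j → V i j` are exactly an
`A i`-`A j`-bimodule structure on `V i j`, and the remaining ones are balanced bimodule maps
`V i j ⊗ V j k → V i k`. -/
structure TriangularData {n : ℕ} (A : Fin n → Type v) [∀ i, Ring (A i)] where
  /-- the entries in position `(i, j)` -/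
  V : Fin n → Fin n → Type v
  [addCommGroup : ∀ i j, AddCommGroup (V i j)]
  /-- the products of entries -/
  mul : ∀ {i j k : Fin n}, V i j →+ V j k →+ V i k
  /-- the units of the diagonal rings -/
  one : ∀ i : Fin n, V i i
  mul_assoc : ∀ {i j k l : Fin n} (x : V i j) (y : V j k) (z : V k l),
    mul (mul x y) z = mul x (mul y z)
  one_mul : ∀ {i j : Fin n} (x : V i j), mul (one i) x = x
  mul_one : ∀ {i j : Fin n} (x : V i j), mul x (one j) = x
  /-- the identification of the diagonal rings with the given ones -/
  diag : ∀ i : Fin n, V i i ≃+ A i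
  diag_one : ∀ i : Fin n, diag i (one i) = 1
  diag_mul : ∀ (i : Fin n) (x y : V i i), diag i (mul x y) = diag i x * diag i y
  lower_eq_zero : ∀ i j : Fin n, j < i → ∀ x : V i j, x = 0

namespace TriangularData

attribute [instance] TriangularData.addCommGroup

variable {n : ℕ} {A : Fin n → Type v} [∀ i, Ring (A i)] (T : TriangularData A)

/-- The upper triangular matrices. -/
def Mat : Type v := ∀ i j : Fin n, T.V i j

instance : AddCommGroup T.Mat := inferInstanceAs (AddCommGroup (∀ i j : Fin n, T.V i j))

/-- Matrix multiplication. -/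
instance : Mul T.Mat := ⟨fun x y i j => ∑ k, T.mul (x i k) (y k j)⟩

/-- The identity matrix. -/
instance : One T.Mat := ⟨fun i => Pi.single i (T.one i)⟩

theorem mul_apply (x y : T.Mat) (i j : Fin n) : (x * y) i j = ∑ k, T.mul (x i k) (y k j) := rfl

theorem add_apply (x y : T.Mat) (i j : Fin n) : (x + y) i j = x i j + y i j := rfl

theorem zero_apply (i j : Fin n) : (0 : T.Mat) i j = 0 := rfl

theorem one_apply_eq (i : Fin n) : (1 : T.Mat) i i = T.one i :=
  Pi.single_eq_same i (T.one i)

theorem one_apply_ne {i j : Fin n} (h : j ≠ i) : (1 : T.Mat) i j = 0 :=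
  Pi.single_eq_of_ne h (T.one i)

@[ext] theorem Mat.ext {T : TriangularData A} {x y : T.Mat} (h : ∀ i j, x i j = y i j) : x = y :=
  funext fun i => funext fun j => h i j

/-- The ring of upper triangular matrices. -/
instance : Ring T.Mat :=
  { (inferInstance : AddCommGroup T.Mat), (inferInstance : Mul T.Mat),
    (inferInstance : One T.Mat) with
    left_distrib := fun x y z => by
      ext i j; simp [mul_apply, add_apply, Finset.sum_add_distrib]
    right_distrib := fun x y z => by
      ext i j; simp [mul_apply, add_apply, Finset.sum_add_distrib]
    zero_mul := fun x => by ext i j; simp [mul_apply, zero_apply]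
    mul_zero := fun x => by ext i j; simp [mul_apply, zero_apply]
    mul_assoc := fun x y z => by
      ext i j
      simp only [mul_apply, map_sum, AddMonoidHom.finsetSum_apply, T.mul_assoc]
      exact Finset.sum_comm
    one_mul := fun x => by
      ext i j
      rw [mul_apply, Finset.sum_eq_single i]
      · rw [one_apply_eq, T.one_mul]
      · intro k _ hk; rw [one_apply_ne T hk]; simp
      · simp
    mul_one := fun x => by
      ext i j
      rw [mul_apply, Finset.sum_eq_single j]
      · rw [one_apply_eq, T.mul_one]
      · intro k _ hk; rw [one_apply_ne T hk.symm]; simp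
      · simp }

/-- The matrix with entry `x` in position `(i, j)` and zeros elsewhere. -/
def single (i j : Fin n) (x : T.V i j) : T.Mat := Pi.single i (Pi.single j x)

end TriangularData

/-- For diagonal rings `A i = Mat_{ℓ i}(D i)`: the diagonal matrix unit `E_{kk}` of
`Mat_{ℓ j}(D j)`, as an idempotent of the triangular matrix ring. -/
def TriangularData.diagUnit {n : ℕ} {ℓ : Fin n → ℕ} {D : Fin n → Type v} [∀ i, DivisionRing (D i)]
    (T : TriangularData fun i => Matrix (Fin (ℓ i)) (Fin (ℓ i)) (D i))
    (j : Fin n) (k : Fin (ℓ j)) : T.Mat :=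
  T.single j j ((T.diag j).symm (Matrix.single k k 1))

/-- `S = End_R(M)` is isomorphic to an upper triangular matrix ring with diagonal rings
`Mat_{ℓ i}(D i)` over division rings `D i` and bimodules `V i j` above the diagonal such that the
following holds. Under the isomorphism, for each `j` the diagonal matrix units of `Mat_{ℓ j}(D j)`
become idempotents `ε` of `S`, whose images `ε M` are the `ℓ j` copies of `H j` in `M`. For each of
them and for `i < j`, the restriction to `ε M` of an endomorphism in `V i j` vanishes as soon
as it vanishes at some nonzero `x` in `ε M`; that is, `l_S(x) ∩ (V i j) ε = 0`. -/
def HasTriangularEnd (R : Type u) [Ring R] (M : Type v) [AddCommGroup M] [Module R M]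
    {n : ℕ} (ℓ : Fin n → ℕ) : Prop :=
  ∃ (D : Fin n → Type v) (_ : ∀ i, DivisionRing (D i))
    (T : TriangularData fun i => Matrix (Fin (ℓ i)) (Fin (ℓ i)) (D i))
    (Φ : T.Mat ≃+* Module.End R M),
    ∀ i j : Fin n, i < j → ∀ k : Fin (ℓ j), ∀ x ∈ LinearMap.range (Φ (T.diagUnit j k)), x ≠ 0 →
      ∀ φ : T.V i j,
        (Φ (T.single i j φ) * Φ (T.diagUnit j k)) x = 0 →
          Φ (T.single i j φ) * Φ (T.diagUnit j k) = 0

/-! ### A criterion for semiprimary rings -/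

/-! Between indecomposable modules, being relatively Rickart means that every homomorphism is zero
or injective, because a kernel that is a direct summand of an indecomposable module is zero or
everything. An indecomposable endoregular module has a division ring as its endomorphism ring, since
the idempotents attached to a von Neumann inverse are trivial.

From (a) to (b): if nonzero maps went both ways between distinct `H i` and `H j`, both would be
injective, their composite would be an automorphism, and the modules would be isomorphic. So "there
is a nonzero map" defines a partial order on the indices (`IsRickartFamily.exists_perm`). A linear
extension of it makes the matrix of Hom groups upper triangular, with diagonal blocks `Mat_{ℓ i}(End
(H i))`. The annihilator condition is then the dichotomy "zero or injective" for maps `H j → H i ^ ℓ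
i`.

From (b) to (a): `H i` is the image of one diagonal matrix unit of block `i`. Maps between these
images are corners of the triangular ring: a division ring for equal indices, zero below the
diagonal, and governed by the annihilator condition above it. The remaining matrix units of a block
identify its copies of `H i`.

The matrices with zero diagonal form a nilpotent ideal with semisimple quotient, so `S` is
semiprimary. The projections onto the indecomposable summands witness the PWD property. For the
corollary, kernels are split by removing one summand at a time, with relative injectivity turning
the kernel into a graph (`isComplemented_ker_of_isRelInjective`). -/

theorem isSemiprimaryRing_of_surjective {S : Type*} {B : Type*} [Ring S] [Ring B]
    [IsSemisimpleRing B] (f : S →+* B) (hf : Function.Surjective f)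
    (hn : IsNilpotent (RingHom.ker f)) : IsSemiprimaryRing S := by
  obtain ⟨m, hm⟩ := hn
  have hnil : ∀ x ∈ RingHom.ker f, IsNilpotent x := fun x hx => by
    refine ⟨m, ?_⟩
    have h := Ideal.pow_mem_pow hx m
    rw [hm] at h
    simpa using h
  -- A surjection sends the radical into the radical of the semisimple ring `B`, which is zero.
  -- Conversely a nil ideal lies in the radical, as `1 + y * x` is a unit.
  have hJ : Ring.jacobson S = RingHom.ker f := by
    apply le_antisymm
    · have : RingHomSurjective f := ⟨hf⟩
      intro x hx
      have h := Ring.le_comap_jacobson f hx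
      rw [IsSemisimpleRing.jacobson_eq_bot] at h
      simpa [RingHom.mem_ker] using h
    · intro x hx
      rw [← Ideal.jacobson_bot, Ideal.mem_jacobson_iff]
      intro y
      have h1 : IsUnit (1 + y * x) := (hnil _ (Ideal.mul_mem_left _ y hx)).isUnit_one_add
      obtain ⟨z, hz⟩ := h1.exists_left_inv
      refine ⟨z, ?_⟩
      rw [Ideal.mem_bot, ← hz]
      noncomm_ring
  refine ⟨?_, ⟨m, hJ ▸ hm⟩⟩
  exact ((Ideal.quotEquivOfEq hJ).trans
    (RingHom.quotientKerEquivOfSurjective hf)).symm.isSemisimpleRing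

/-! ### The diagonal map of a triangular matrix ring and its nilpotent kernel -/

namespace TriangularData

variable {n : ℕ} {A : Fin n → Type v} [∀ i, Ring (A i)] (T : TriangularData A)

theorem single_apply_same (i j : Fin n) (x : T.V i j) : T.single i j x i j = x := by
  simp [TriangularData.single]

theorem single_apply_of_ne_row {i j : Fin n} (x : T.V i j) {a : Fin n} (h : a ≠ i) (b : Fin n) :
    T.single i j x a b = 0 := by
  simp [TriangularData.single, Pi.single_eq_of_ne h]

theorem single_apply_of_ne_col {i j : Fin n} (x : T.V i j) (a : Fin n) {b : Fin n} (h : b ≠ j) :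
    T.single i j x a b = 0 := by
  rcases eq_or_ne a i with rfl | ha
  · simp [TriangularData.single, Pi.single_eq_of_ne h]
  · exact T.single_apply_of_ne_row x ha b

/-- The diagonal of a triangular matrix. -/
def diagHom : T.Mat →+* ∀ i, A i where
  toFun x i := T.diag i (x i i)
  map_zero' := by ext i; simp [zero_apply]
  map_add' x y := by ext i; simp [add_apply]
  map_one' := by ext i; simp [one_apply_eq, T.diag_one]
  map_mul' x y := by
    ext i
    rw [mul_apply, Finset.sum_eq_single i]
    · exact T.diag_mul i _ _
    · intro k _ hk
      rcases lt_or_gt_of_ne hk with h | h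
      · rw [T.lower_eq_zero i k h (x i k)]; simp
      · rw [T.lower_eq_zero k i h (y k i)]; simp
    · simp

theorem diagHom_surjective : Function.Surjective T.diagHom := by
  classical
  intro a
  refine ⟨fun i => Pi.single i ((T.diag i).symm (a i)), ?_⟩
  ext i
  simp [diagHom]

/-- The matrices whose entries `(i, j)` with `j < i + k` vanish. -/
def bandIdeal (k : ℕ) : Ideal T.Mat where
  carrier := {x | ∀ i j : Fin n, (j : ℕ) < i + k → x i j = 0}
  zero_mem' _ _ _ := rfl
  add_mem' hx hy i j h := by rw [add_apply, hx i j h, hy i j h, add_zero]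
  smul_mem' c x hx i j h := by
    rw [smul_eq_mul, mul_apply]
    refine Finset.sum_eq_zero fun l _ => ?_
    by_cases hl : l < i
    · rw [T.lower_eq_zero i l hl (c i l)]; simp
    · rw [hx l j (by rw [not_lt, Fin.le_def] at hl; omega)]; simp

/-- Each factor with zero diagonal pushes the support at least one diagonal further up; the case `k
= 0` is upper triangularity itself. -/
theorem ker_diagHom_pow_le (k : ℕ) : RingHom.ker T.diagHom ^ k ≤ T.bandIdeal k := by
  induction k with
  | zero =>
    intro x _ i j h
    exact T.lower_eq_zero i j (by rw [Fin.lt_def]; omega) _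
  | succ k ih =>
    rw [Submodule.pow_succ, Ideal.mul_le]
    intro x hx y hy i j h
    rw [mul_apply]
    refine Finset.sum_eq_zero fun l _ => ?_
    by_cases hl : (l : ℕ) < i + k
    · rw [ih hx i l hl]; simp
    · have hy0 : y l j = 0 := by
        rcases lt_trichotomy j l with h' | h' | h'
        · exact T.lower_eq_zero l j h' _
        · subst h'
          have := congrFun (RingHom.mem_ker.1 hy) j
          simpa [diagHom] using this
        · rw [Fin.lt_def] at h'; omega
      rw [hy0]; simp

theorem isSemiprimaryRing_of_ringEquiv [∀ i, IsSemisimpleRing (A i)] {S : Type*} [Ring S]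
    (Φ : T.Mat ≃+* S) : IsSemiprimaryRing S := by
  refine isSemiprimaryRing_of_surjective (T.diagHom.comp (Φ.symm : S →+* T.Mat))
    (T.diagHom_surjective.comp Φ.symm.surjective) ⟨n, ?_⟩
  have key : ∀ k : ℕ, RingHom.ker (T.diagHom.comp (Φ.symm : S →+* T.Mat)) ^ k ≤
      (RingHom.ker T.diagHom ^ k).comap (Φ.symm : S →+* T.Mat) := by
    intro k
    induction k with
    | zero =>
      rw [Submodule.pow_zero, Submodule.pow_zero, Ideal.one_eq_top, Ideal.one_eq_top]
      exact fun _ _ => trivial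
    | succ k ih =>
      rw [Submodule.pow_succ, Submodule.pow_succ, Ideal.mul_le]
      intro x hx y hy
      rw [Ideal.mem_comap, map_mul]
      exact Ideal.mul_mem_mul (ih hx) hy
  refine le_bot_iff.1 fun x hx => ?_
  have h := T.ker_diagHom_pow_le n (key n hx)
  have h0 : Φ.symm x = 0 := by
    ext i j
    -- Every column index satisfies `j < n ≤ i + n`, so the `n`-th band ideal is zero.
    exact h i j (by omega)
  simpa using h0

end TriangularData

/-! ### Modules between which all homomorphisms are zero or injective -/

section Maps

variable (K : Type u) [Ring K]

/-- Every homomorphism `M → N` is zero or injective. -/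
def MapsZeroOrInjective (M : Type v) [AddCommGroup M] [Module K M]
    (N : Type w) [AddCommGroup N] [Module K N] : Prop :=
  ∀ f : M →ₗ[K] N, f = 0 ∨ Function.Injective f

variable {K}

theorem MapsZeroOrInjective.isRelRickart {M : Type v} [AddCommGroup M] [Module K M]
    {N : Type w} [AddCommGroup N] [Module K N] (h : MapsZeroOrInjective K M N) :
    IsRelRickart K M N := by
  intro f
  rcases h f with rfl | hf
  · rw [LinearMap.ker_zero]; exact isComplemented_top
  · rw [LinearMap.ker_eq_bot.2 hf]; exact isComplemented_bot

theorem IsRelRickart.mapsZeroOrInjective {M : Type v} [AddCommGroup M] [Module K M]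
    {N : Type w} [AddCommGroup N] [Module K N] (h : IsRelRickart K M N)
    (hM : IsIndecomposableModule K M) : MapsZeroOrInjective K M N := by
  intro f
  obtain ⟨C, hC⟩ := h f
  rcases hM.2 _ _ hC with h0 | h0
  · exact .inr (LinearMap.ker_eq_bot.1 h0)
  · subst h0
    exact .inl (LinearMap.ker_eq_top.1 (by simpa using hC.sup_eq_top))

/-- A nonzero map has a nonzero component, and that component is already injective. -/
theorem MapsZeroOrInjective.pi {M : Type v} [AddCommGroup M] [Module K M] {ι : Type*}
    {N : ι → Type w} [∀ i, AddCommGroup (N i)] [∀ i, Module K (N i)]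
    (h : ∀ i, MapsZeroOrInjective K M (N i)) : MapsZeroOrInjective K M (∀ i, N i) := by
  intro f
  by_cases hf : ∀ i, LinearMap.proj i ∘ₗ f = 0
  · left
    ext x i
    exact LinearMap.congr_fun (hf i) x
  · push Not at hf
    obtain ⟨i, hi⟩ := hf
    exact .inr (Function.Injective.of_comp (f := LinearMap.proj (R := K) (φ := N) i)
      ((h i _).resolve_left hi))

theorem MapsZeroOrInjective.congr_right {M : Type v} [AddCommGroup M] [Module K M]
    {N N' : Type*} [AddCommGroup N] [Module K N] [AddCommGroup N'] [Module K N']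
    (h : MapsZeroOrInjective K M N) (e : N' ≃ₗ[K] N) : MapsZeroOrInjective K M N' := by
  intro f
  rcases h (e.toLinearMap ∘ₗ f) with h | h
  · left
    ext x
    simpa using LinearMap.congr_fun h x
  · exact .inr (Function.Injective.of_comp (f := e) h)

/-- If `f g f = f`, then `f g` and `g f` are idempotents, hence `0` or `1` by indecomposability. If
either is `0` then so is `f`; otherwise `g` is a two-sided inverse. -/
theorem IsEndoregular.isUnit_or_eq_zero {M : Type v} [AddCommGroup M] [Module K M]
    (h : IsEndoregular K M) (hM : IsIndecomposableModule K M) (f : Module.End K M) :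
    IsUnit f ∨ f = 0 := by
  have hidem : ∀ e : Module.End K M, IsIdempotentElem e → e = 0 ∨ e = 1 := by
    intro e he
    rcases hM.2 _ _ (LinearMap.IsIdempotentElem.isCompl he) with h0 | h0
    · exact .inl (LinearMap.range_eq_bot.1 h0)
    · right
      ext x
      apply LinearMap.ker_eq_bot.1 h0
      simpa using LinearMap.congr_fun he x
  obtain ⟨g, hg⟩ := h f
  have h1 : IsIdempotentElem (f * g) := by
    rw [IsIdempotentElem, ← mul_assoc, hg]
  have h2 : IsIdempotentElem (g * f) := by
    rw [IsIdempotentElem, mul_assoc, ← mul_assoc f, hg]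
  rcases hidem _ h1 with h1 | h1
  · right; rw [← hg, h1, zero_mul]
  rcases hidem _ h2 with h2 | h2
  · right; rw [← hg, mul_assoc, h2, mul_zero]
  exact .inl ⟨⟨f, g, h1, h2⟩, rfl⟩

/-- The idempotents are the projections onto the summands, so corner elements are maps between
summands. If `x y = 0` with `y ≠ 0`, the map given by `x` cannot be injective, hence vanishes. -/
theorem isPiecewiseDomain_of_mapsZeroOrInjective {ι : Type*} [Finite ι] {G : ι → Type w}
    [∀ i, AddCommGroup (G i)] [∀ i, Module K (G i)]
    (hG : ∀ i j, MapsZeroOrInjective K (G i) (G j)) {M : Type v} [AddCommGroup M] [Module K M]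
    (e : M ≃ₗ[K] ∀ i, G i) : IsPiecewiseDomain (Module.End K M) := by
  classical
  have := Fintype.ofFinite ι
  let q := (Fintype.equivFin ι).symm
  let pr : ∀ a, M →ₗ[K] G (q a) := fun a => LinearMap.proj (q a) ∘ₗ e.toLinearMap
  let inj : ∀ a, G (q a) →ₗ[K] M := fun a => e.symm.toLinearMap ∘ₗ LinearMap.single K G (q a)
  have hpi : ∀ a (z : G (q a)), pr a (inj a z) = z := fun a z => by simp [pr, inj]
  have hpi' : ∀ a b (z : G (q b)), a ≠ b → pr a (inj b z) = 0 := fun a b z hab => by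
    simp only [pr, inj, LinearMap.comp_apply, LinearEquiv.coe_coe, LinearEquiv.apply_symm_apply,
      LinearMap.proj_apply, LinearMap.single_apply]
    exact Pi.single_eq_of_ne (fun h => hab (q.injective h)) z
  refine ⟨Fintype.card ι, fun a => inj a ∘ₗ pr a, ⟨⟨fun a => ?_, fun a b hab => ?_⟩, ?_⟩, ?_⟩
  · ext x
    simp [hpi]
  · ext x
    simp [hpi' a b _ hab]
  · ext x
    apply e.injective
    rw [LinearMap.sum_apply, map_sum]
    have h1 : ∀ a, e ((inj a ∘ₗ pr a) x) = Pi.single (q a) (e x (q a)) := fun a => by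
      simp [inj, pr]
    simp_rw [h1]
    rw [q.sum_comp (fun i => Pi.single i (e x i)), Finset.univ_sum_single]
    rfl
  · intro a b c x y hx hy hxy
    by_cases hy0 : y = 0
    · exact .inr hy0
    left
    have hx0 : pr a ∘ₗ x ∘ₗ inj b = 0 := by
      rcases hG _ _ (pr a ∘ₗ x ∘ₗ inj b) with h | h
      · exact h
      · exfalso
        apply hy0
        rw [← hy] at hxy ⊢
        ext z
        have h1 : (pr a ∘ₗ x ∘ₗ inj b) (pr b (y (inj c (pr c z)))) = 0 := by
          have := congrArg (pr a) (LinearMap.congr_fun hxy z)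
          simpa using this
        have h2 := h (h1.trans (map_zero _).symm)
        simp [h2]
    rw [← hx]
    ext z
    have := LinearMap.congr_fun hx0 (pr b z)
    simp only [LinearMap.comp_apply, LinearMap.zero_apply] at this
    simp [this]

end Maps

/-- Szpilrajn's extension theorem gives a linear order containing `r`; `σ` enumerates it
increasingly. -/
theorem exists_equiv_fin_of_isPartialOrder {α : Type*} [Fintype α] {n : ℕ}
    (hn : Fintype.card α = n) (r : α → α → Prop) [IsPartialOrder α r] :
    ∃ σ : Fin n ≃ α, ∀ i j, r (σ i) (σ j) → i ≤ j := by
  classical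
  obtain ⟨s, hs, hrs⟩ := extend_partialOrder r
  let : LinearOrder α :=
    { le := s
      le_refl := hs.refl
      le_trans := hs.trans
      le_antisymm := hs.antisymm
      le_total := hs.total
      toDecidableLE := Classical.decRel _ }
  let e := monoEquivOfFin α hn
  exact ⟨e.toEquiv, fun i j h => e.le_iff_le.1 (hrs _ _ h)⟩

/-! ### Endomorphism rings as triangular matrix rings -/

namespace TriangularData

variable {K : Type u} [Ring K] {n : ℕ} (G : Fin n → Type v) [∀ i, AddCommGroup (G i)]
  [∀ i, Module K (G i)] {A : Fin n → Type v} [∀ i, Ring (A i)]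
  (e : ∀ i, Module.End K (G i) ≃+* A i) (h : ∀ i j, j < i → ∀ f : G j →ₗ[K] G i, f = 0)

/-- The triangular matrix data with entries `Hom(G j, G i)`. -/
def ofHom : TriangularData A where
  V i j := G j →ₗ[K] G i
  mul := AddMonoidHom.mk' (fun x =>
    AddMonoidHom.mk' (fun y => x ∘ₗ y) fun y y' => LinearMap.comp_add y y' x)
    fun x x' => AddMonoidHom.ext fun y => LinearMap.add_comp y x' x
  one _ := LinearMap.id
  mul_assoc _ _ _ := rfl
  one_mul _ := rfl
  mul_one _ := rfl
  diag i := (e i).toAddEquiv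
  diag_one i := map_one (e i)
  diag_mul i := map_mul (e i)
  lower_eq_zero := h

variable {G e h} in
/-- The entries of a triangular matrix of homomorphisms. -/
def entry (x : (ofHom G e h).Mat) (i j : Fin n) : G j →ₗ[K] G i := x i j

variable {G e h} in
theorem entry_mul (x y : (ofHom G e h).Mat) (i j : Fin n) :
    entry (x * y) i j = ∑ k, entry x i k ∘ₗ entry y k j := rfl

variable {G e h} in
theorem entry_add (x y : (ofHom G e h).Mat) (i j : Fin n) :
    entry (x + y) i j = entry x i j + entry y i j := rfl

/-- The ring of triangular matrices with entries in `Hom(G j, G i)` is `End (∏ i, G i)`. -/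
def ofHomEquiv : (ofHom G e h).Mat ≃+* Module.End K (∀ i, G i) where
  toFun x := LinearMap.pi fun i => ∑ j, entry x i j ∘ₗ LinearMap.proj j
  invFun f i j := LinearMap.proj i ∘ₗ f ∘ₗ LinearMap.single K G j
  left_inv x := by
    refine Mat.ext (T := ofHom G e h) fun i j => ?_
    change LinearMap.proj i ∘ₗ (LinearMap.pi fun i => ∑ j, entry x i j ∘ₗ LinearMap.proj j) ∘ₗ
      LinearMap.single K G j = entry x i j
    refine LinearMap.ext fun z => ?_
    simp only [LinearMap.comp_apply, LinearMap.proj_apply, LinearMap.pi_apply,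
      LinearMap.sum_apply, LinearMap.single_apply]
    rw [Finset.sum_eq_single j]
    · rw [Pi.single_eq_same]
    · intro k _ hk
      rw [Pi.single_eq_of_ne hk, map_zero]
    · simp
  right_inv f := by
    refine LinearMap.pi_ext' fun j => LinearMap.ext fun z => funext fun i => ?_
    simp only [LinearMap.comp_apply, LinearMap.pi_apply, LinearMap.sum_apply,
      LinearMap.proj_apply, LinearMap.single_apply]
    rw [Finset.sum_eq_single j]
    · rw [Pi.single_eq_same]; rfl
    · intro k _ hk
      rw [Pi.single_eq_of_ne hk, map_zero]
    · simp
  map_add' x y := by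
    refine LinearMap.ext fun z => funext fun i => ?_
    simp [entry_add, LinearMap.add_apply, Finset.sum_add_distrib]
  map_mul' x y := by
    refine LinearMap.ext fun z => funext fun i => ?_
    simp only [entry_mul, LinearMap.pi_apply, Module.End.mul_apply, LinearMap.sum_apply,
      LinearMap.comp_apply, LinearMap.proj_apply, map_sum]
    exact Finset.sum_comm

theorem ofHomEquiv_single (i j : Fin n) (φ : G j →ₗ[K] G i) :
    ofHomEquiv G e h ((ofHom G e h).single i j φ) =
      LinearMap.single K G i ∘ₗ φ ∘ₗ LinearMap.proj j := by
  rw [← RingEquiv.eq_symm_apply]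
  refine Mat.ext fun a b => ?_
  change _ = LinearMap.proj a ∘ₗ (LinearMap.single K G i ∘ₗ φ ∘ₗ LinearMap.proj j) ∘ₗ
    LinearMap.single K G b
  rcases eq_or_ne a i with rfl | ha
  · rcases eq_or_ne b j with rfl | hb
    · refine (single_apply_same _ _ _ _).trans ?_
      refine LinearMap.ext fun z => ?_
      simp
    · refine (single_apply_of_ne_col _ _ _ hb).trans (Eq.symm (LinearMap.ext fun z => ?_))
      simp [Pi.single_eq_of_ne hb.symm]
      rfl
  · refine (single_apply_of_ne_row _ _ ha _).trans (Eq.symm (LinearMap.ext fun z => ?_))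
    simp [Pi.single_eq_of_ne ha]
    rfl

end TriangularData

/-! ### Ordering a Rickart family and triangularizing its endomorphism ring -/

namespace IsRickartFamily

variable {K : Type u} [Ring K] {n : ℕ} {H : Fin n → Type v} [∀ i, AddCommGroup (H i)]
  [∀ i, Module K (H i)]

theorem mapsZeroOrInjective (hH : IsRickartFamily K H) (i j : Fin n) :
    MapsZeroOrInjective K (H i) (H j) :=
  (hH.relRickart i j).mapsZeroOrInjective (hH.indecomposable i)

theorem comp_perm (hH : IsRickartFamily K H) (σ : Equiv.Perm (Fin n)) :
    IsRickartFamily K fun i => H (σ i) where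
  indecomposable i := hH.indecomposable (σ i)
  endoregular i := hH.endoregular (σ i)
  relRickart i j := hH.relRickart (σ i) (σ j)
  not_iso i j hij := hH.not_iso (σ i) (σ j) (σ.injective.ne hij)

/-- The endomorphism ring of a member of the family is a division ring. -/
noncomputable abbrev divisionRing (hH : IsRickartFamily K H) (i : Fin n) :
    DivisionRing (Module.End K (H i)) :=
  have := (hH.indecomposable i).1
  DivisionRing.ofIsUnitOrEqZero
    ((hH.endoregular i).isUnit_or_eq_zero (hH.indecomposable i))

/-- Two nonzero maps would both be injective. Then `f ∘ g` is an injective, hence nonzero, element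
of a division ring, so it is bijective; thus `f` is also surjective and `H i ≅ H j`. -/
theorem eq_zero_or_eq_zero (hH : IsRickartFamily K H) {i j : Fin n} (hij : i ≠ j)
    (f : H i →ₗ[K] H j) (g : H j →ₗ[K] H i) : f = 0 ∨ g = 0 := by
  rcases hH.mapsZeroOrInjective i j f with hf | hf
  · exact .inl hf
  rcases hH.mapsZeroOrInjective j i g with hg | hg
  · exact .inr hg
  exfalso
  have bij : ∀ (k : Fin n) (φ : Module.End K (H k)), Function.Injective φ →
      Function.Bijective φ := fun k φ hφ => by
    rcases (hH.endoregular k).isUnit_or_eq_zero (hH.indecomposable k) φ with h | h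
    · exact (Module.End.isUnit_iff φ).1 h
    · subst h
      have := (hH.indecomposable k).1
      obtain ⟨x, y, hxy⟩ := exists_pair_ne (H k)
      exact absurd (hφ (by simp)) hxy
  have h1 := bij j (f ∘ₗ g) (hf.comp hg)
  exact (hH.not_iso i j hij).false
    (LinearEquiv.ofBijective f ⟨hf, Function.Surjective.of_comp (g := g) h1.2⟩)

theorem exists_perm (hH : IsRickartFamily K H) :
    ∃ σ : Equiv.Perm (Fin n), ∀ i j, j < i → ∀ f : H (σ j) →ₗ[K] H (σ i), f = 0 := by
  -- Transitivity holds because composing with an injective map on the left preserves being nonzero;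
  -- antisymmetry is `eq_zero_or_eq_zero`. A map `H b → H a` puts `a` before `b`, matching the entry
  -- in position `(a, b)`.
  let r : Fin n → Fin n → Prop := fun a b => a = b ∨ ∃ f : H b →ₗ[K] H a, f ≠ 0
  have : IsPartialOrder (Fin n) r :=
    { refl := fun a => .inl rfl
      trans := by
        rintro a b c (rfl | ⟨f, hf⟩) (rfl | ⟨g, hg⟩)
        · exact .inl rfl
        · exact .inr ⟨g, hg⟩
        · exact .inr ⟨f, hf⟩
        · refine .inr ⟨f ∘ₗ g, fun h0 => hg ?_⟩
          ext x
          apply (hH.mapsZeroOrInjective _ _ f).resolve_left hf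
          simpa using LinearMap.congr_fun h0 x
      antisymm := by
        rintro a b (rfl | ⟨f, hf⟩) (h | ⟨g, hg⟩)
        · rfl
        · rfl
        · exact h.symm
        · by_contra hab
          rcases hH.eq_zero_or_eq_zero hab g f with h | h
          exacts [hg h, hf h] }
  obtain ⟨σ, hσ⟩ := exists_equiv_fin_of_isPartialOrder (Fintype.card_fin n) r
  refine ⟨σ, fun i j hji f => ?_⟩
  by_contra hf
  exact absurd (hσ i j (.inr ⟨f, hf⟩)) (not_le.2 hji)

theorem hasTriangularEnd (hH : IsRickartFamily K H) {M : Type v} [AddCommGroup M] [Module K M]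
    {ℓ : Fin n → ℕ} (e : M ≃ₗ[K] ∀ i, Fin (ℓ i) → H i)
    (h : ∀ i j, j < i → ∀ f : H j →ₗ[K] H i, f = 0) : HasTriangularEnd K M ℓ := by
  have h' : ∀ i j, j < i → ∀ f : (Fin (ℓ j) → H j) →ₗ[K] (Fin (ℓ i) → H i), f = 0 := by
    intro i j hji f
    refine LinearMap.pi_ext' fun k => ?_
    ext x l
    exact LinearMap.congr_fun (h i j hji
      (LinearMap.proj l ∘ₗ f ∘ₗ LinearMap.single K (fun _ => H j) k)) x
  let (i : Fin n) : DivisionRing (Module.End K (H i)) := hH.divisionRing i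
  let en : ∀ i, Module.End K (Fin (ℓ i) → H i) ≃+*
      Matrix (Fin (ℓ i)) (Fin (ℓ i)) (Module.End K (H i)) := fun i =>
    endVecRingEquivMatrixEnd (Fin (ℓ i)) K (H i)
  refine ⟨fun i => Module.End K (H i), hH.divisionRing,
    TriangularData.ofHom (fun i => Fin (ℓ i) → H i) en h',
    (TriangularData.ofHomEquiv _ en h').trans e.symm.conjRingEquiv, ?_⟩
  intro i j _ k x hx hx0 φ
  change (Fin (ℓ j) → H j) →ₗ[K] (Fin (ℓ i) → H i) at φ
  -- The diagonal matrix unit acts as the projection onto the `k`-th copy of `H j`, so the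
  -- annihilator condition concerns only the restriction of `φ` to that copy.
  have hunit : (en j).symm (Matrix.single k k 1) =
      LinearMap.single K (fun _ => H j) k ∘ₗ LinearMap.proj k := by
    refine LinearMap.ext fun y => funext fun a => ?_
    change ∑ b, (Matrix.single k k 1 : Matrix _ _ (Module.End K (H j))) a b (y b) =
      Pi.single (M := fun _ => H j) k (y k) a
    rcases eq_or_ne a k with rfl | ha
    · rw [Finset.sum_eq_single a]
      · simp
      · intro b _ hb
        simp [hb.symm]
      · simp
    · simp [ha, ha.symm]
  have hu : ∀ y, ((TriangularData.ofHomEquiv _ en h').trans e.symm.conjRingEquiv)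
      ((TriangularData.ofHom _ en h').diagUnit j k) y =
      e.symm (Pi.single j (Pi.single k (e y j k))) := fun y => by
    have h1 := TriangularData.ofHomEquiv_single _ en h' j j
      (((TriangularData.ofHom _ en h').diag j).symm (Matrix.single k k 1))
    refine (congrArg e.symm (LinearMap.congr_fun h1 (e y))).trans ?_
    refine congrArg (fun f => e.symm (Pi.single j (f (e y j)))) hunit
  have hprod : ∀ y, ((TriangularData.ofHomEquiv _ en h').trans e.symm.conjRingEquiv
      ((TriangularData.ofHom _ en h').single i j φ) *
      (TriangularData.ofHomEquiv _ en h').trans e.symm.conjRingEquiv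
      ((TriangularData.ofHom _ en h').diagUnit j k)) y =
      e.symm (Pi.single i (φ (Pi.single k (e y j k)))) := fun y => by
    have h1 := TriangularData.ofHomEquiv_single _ en h' i j φ
    have h2 := congrArg e.symm (LinearMap.congr_fun h1
      (e (((TriangularData.ofHomEquiv _ en h').trans e.symm.conjRingEquiv)
        ((TriangularData.ofHom _ en h').diagUnit j k) y)))
    refine Eq.trans h2 ?_
    rw [hu]
    simp
  obtain ⟨w, rfl⟩ := hx
  intro hz
  -- The restriction `H j → H i ^ ℓ i` is zero or injective; vanishing at the nonzero vector `e w j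
  -- k` excludes injectivity.
  have hφ := MapsZeroOrInjective.pi (fun _ : Fin (ℓ i) => hH.mapsZeroOrInjective j i)
    (φ ∘ₗ LinearMap.single K (fun _ => H j) k)
  rw [hu] at hx0 hz
  rw [hprod] at hz
  have hz' : (φ ∘ₗ LinearMap.single K (fun _ => H j) k) (e w j k) = 0 := by simpa using hz
  have hφ0 : φ ∘ₗ LinearMap.single K (fun _ => H j) k = 0 := hφ.resolve_right fun hinj => by
    apply hx0
    rw [hinj (hz'.trans (map_zero _).symm)]
    simp
  refine LinearMap.ext fun y => ?_
  rw [hprod]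
  have := LinearMap.congr_fun hφ0 (e y j k)
  simp only [LinearMap.comp_apply, LinearMap.single_apply, LinearMap.zero_apply] at this
  rw [this]
  simp

end IsRickartFamily

/-! ### Consequences of a Rickart decomposition -/

theorem HasRickartDecomposition.comp_perm {K : Type u} [Ring K] {M : Type v} [AddCommGroup M]
    [Module K M] {n : ℕ} {ℓ : Fin n → ℕ} (h : HasRickartDecomposition K M ℓ)
    (σ : Equiv.Perm (Fin n)) : HasRickartDecomposition K M (ℓ ∘ σ) := by
  obtain ⟨H, _, _, hH, ⟨e⟩⟩ := h
  exact ⟨fun i => H (σ i), inferInstance, inferInstance, hH.comp_perm σ,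
    ⟨e.trans (LinearEquiv.piCongrLeft K (fun i => Fin (ℓ i) → H i) σ).symm⟩⟩

theorem HasRickartDecomposition.exists_hasTriangularEnd {K : Type u} [Ring K] {M : Type v}
    [AddCommGroup M] [Module K M] {n : ℕ} {ℓ : Fin n → ℕ} (h : HasRickartDecomposition K M ℓ) :
    ∃ σ : Equiv.Perm (Fin n), HasTriangularEnd K M (ℓ ∘ σ) := by
  obtain ⟨H, _, _, hH, ⟨e⟩⟩ := h
  obtain ⟨σ, hσ⟩ := hH.exists_perm
  exact ⟨σ, (hH.comp_perm σ).hasTriangularEnd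
    (e.trans (LinearEquiv.piCongrLeft K (fun i => Fin (ℓ i) → H i) σ).symm) hσ⟩

theorem HasRickartDecomposition.isPiecewiseDomain {K : Type u} [Ring K] {M : Type v}
    [AddCommGroup M] [Module K M] {n : ℕ} {ℓ : Fin n → ℕ} (h : HasRickartDecomposition K M ℓ) :
    IsPiecewiseDomain (Module.End K M) := by
  obtain ⟨H, _, _, hH, ⟨e⟩⟩ := h
  exact isPiecewiseDomain_of_mapsZeroOrInjective
    (G := fun p : Σ i, Fin (ℓ i) => H p.1) (fun p q => hH.mapsZeroOrInjective p.1 q.1)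
    (e.trans (LinearEquiv.piCurry K (fun i (_ : Fin (ℓ i)) => H i)).symm)

theorem HasTriangularEnd.isSemiprimaryRing {K : Type u} [Ring K] {M : Type v}
    [AddCommGroup M] [Module K M] {n : ℕ} {ℓ : Fin n → ℕ} (h : HasTriangularEnd K M ℓ) :
    IsSemiprimaryRing (Module.End K M) := by
  obtain ⟨D, _, T, Φ, -⟩ := h
  exact T.isSemiprimaryRing_of_ringEquiv Φ

theorem HasRickartDecomposition.isSemiprimaryRing {K : Type u} [Ring K] {M : Type v}
    [AddCommGroup M] [Module K M] {n : ℕ} {ℓ : Fin n → ℕ} (h : HasRickartDecomposition K M ℓ) :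
    IsSemiprimaryRing (Module.End K M) :=
  h.exists_hasTriangularEnd.choose_spec.isSemiprimaryRing

/-! ### Matrix units in a triangular matrix ring -/

namespace TriangularData

variable {n : ℕ} {A : Fin n → Type v} [∀ i, Ring (A i)] (T : TriangularData A)

theorem single_mul_single (i j k : Fin n) (x : T.V i j) (y : T.V j k) :
    T.single i j x * T.single j k y = T.single i k (T.mul x y) := by
  ext a b
  rw [mul_apply, Finset.sum_eq_single j]
  · rcases eq_or_ne a i with rfl | ha
    · rcases eq_or_ne b k with rfl | hb
      · simp only [single_apply_same]
      · simp [single_apply_of_ne_col T _ _ hb]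
    · simp [single_apply_of_ne_row T _ ha]
  · intro l _ hl
    simp [single_apply_of_ne_col T _ _ hl]
  · simp

theorem single_mul_single_of_ne {i j j' k : Fin n} (h : j ≠ j') (x : T.V i j) (y : T.V j' k) :
    T.single i j x * T.single j' k y = 0 := by
  ext a b
  rw [mul_apply]
  refine Finset.sum_eq_zero fun l _ => ?_
  rcases eq_or_ne l j with rfl | hl
  · simp [single_apply_of_ne_row T y h]
  · simp [single_apply_of_ne_col T x a hl]

theorem single_zero (i j : Fin n) : T.single i j 0 = 0 := by
  simp only [single, Pi.single_zero]; rfl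

theorem single_add (i j : Fin n) (x y : T.V i j) :
    T.single i j (x + y) = T.single i j x + T.single i j y := by
  simp only [single, Pi.single_add]; rfl

theorem single_sum {ι : Type*} (s : Finset ι) (i j : Fin n) (x : ι → T.V i j) :
    T.single i j (∑ k ∈ s, x k) = ∑ k ∈ s, T.single i j (x k) :=
  map_sum (AddMonoidHom.mk' (T.single i j) (T.single_add i j)) x s

theorem sum_single_one : ∑ i, T.single i i (T.one i) = 1 :=
  Finset.univ_sum_single (1 : T.Mat)

theorem single_injective (i j : Fin n) : Function.Injective (T.single i j) := fun x y h => by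
  rw [← T.single_apply_same i j x, h, single_apply_same]

theorem single_mul_mul_single (i j : Fin n) (a : T.V i i) (t : T.Mat) (b : T.V j j) :
    T.single i i a * t * T.single j j b = T.single i j (T.mul (T.mul a (t i j)) b) := by
  ext p q
  rw [mul_apply, Finset.sum_eq_single j]
  · rw [mul_apply, Finset.sum_eq_single i]
    · rcases eq_or_ne p i with rfl | hp
      · rcases eq_or_ne q j with rfl | hq
        · simp only [single_apply_same]
        · simp [single_apply_of_ne_col T _ _ hq]
      · simp [single_apply_of_ne_row T _ hp]
    · intro l _ hl
      simp [single_apply_of_ne_col T _ _ hl]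
    · simp
  · intro l _ hl
    simp [single_apply_of_ne_row T _ hl]
  · simp

section MatrixUnits

variable {ℓ : Fin n → ℕ} {D : Fin n → Type v} [∀ i, DivisionRing (D i)]
  (T : TriangularData fun i => Matrix (Fin (ℓ i)) (Fin (ℓ i)) (D i))

/-- The matrix `d E_{kl}` in the `i`-th diagonal block. -/
def unit (i : Fin n) (k l : Fin (ℓ i)) (d : D i) : T.Mat :=
  T.single i i ((T.diag i).symm (Matrix.single k l d))

theorem diag_symm_mul (i : Fin n) (x y : Matrix (Fin (ℓ i)) (Fin (ℓ i)) (D i)) :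
    T.mul ((T.diag i).symm x) ((T.diag i).symm y) = (T.diag i).symm (x * y) := by
  apply (T.diag i).injective
  rw [T.diag_mul]
  simp

theorem unit_mul_unit (i : Fin n) (k l m : Fin (ℓ i)) (c d : D i) :
    T.unit i k l c * T.unit i l m d = T.unit i k m (c * d) := by
  rw [unit, unit, single_mul_single, diag_symm_mul, Matrix.single_mul_single_same]
  rfl

theorem unit_mul_unit_of_ne (i : Fin n) {k l l' m : Fin (ℓ i)} (h : l ≠ l') (c d : D i) :
    T.unit i k l c * T.unit i l' m d = 0 := by
  rw [unit, unit, single_mul_single, diag_symm_mul, Matrix.single_mul_single_of_ne (h := h),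
    map_zero, single_zero]

theorem unit_mul_unit_of_block_ne {i j : Fin n} (h : i ≠ j) (k l : Fin (ℓ i)) (k' l' : Fin (ℓ j))
    (c : D i) (d : D j) : T.unit i k l c * T.unit j k' l' d = 0 :=
  T.single_mul_single_of_ne h _ _

theorem sum_unit_eq_one : ∑ i, ∑ k, T.unit i k k 1 = 1 := by
  rw [← T.sum_single_one]
  refine Finset.sum_congr rfl fun i _ => ?_
  unfold unit
  rw [← single_sum, ← map_sum]
  congr 1
  rw [AddEquiv.symm_apply_eq, T.diag_one]
  ext a b
  rw [Matrix.sum_apply, Finset.sum_eq_single a]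
  · simp [Matrix.single_apply, Matrix.one_apply]
  · intro c _ hc
    simp [hc]
  · simp

theorem unit_one_ne_zero (i : Fin n) (k l : Fin (ℓ i)) : T.unit i k l 1 ≠ 0 := by
  intro h
  rw [← T.single_zero i i] at h
  have h1 := (AddEquiv.symm_apply_eq _).1 (T.single_injective i i h)
  have h2 := congrFun (congrFun h1 k) l
  simp at h2

/-- The corner at a diagonal matrix unit of block `i` is a copy of `D i`: only the `(k, k)` entry of
the diagonal block `t i i` survives. -/
theorem exists_eq_unit_of_unit_mul_mul_unit {i : Fin n} {k : Fin (ℓ i)} {t : T.Mat}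
    (ht : T.unit i k k 1 * t * T.unit i k k 1 = t) : ∃ d, t = T.unit i k k d := by
  refine ⟨T.diag i (t i i) k k, ?_⟩
  have h := T.single_mul_mul_single i i ((T.diag i).symm (Matrix.single k k 1)) t
    ((T.diag i).symm (Matrix.single k k 1))
  rw [← (T.diag i).symm_apply_apply (t i i), diag_symm_mul, diag_symm_mul,
    Matrix.single_mul_mul_single, _root_.one_mul, _root_.mul_one] at h
  exact ht.symm.trans h

end MatrixUnits

end TriangularData

/-! ### From the triangular ring back to the decomposition -/

section Converse

variable {K : Type u} [Ring K] {M : Type v} [AddCommGroup M] [Module K M] {n : ℕ} {ℓ : Fin n → ℕ}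

/-- Apply the hypothesis to the projection onto one summand along the other. -/
theorem isIndecomposableModule_of_eq_zero_or_bijective {N : Type*} [AddCommGroup N] [Module K N]
    [Nontrivial N] (h : ∀ f : N →ₗ[K] N, f = 0 ∨ Function.Bijective f) :
    IsIndecomposableModule K N := by
  refine ⟨inferInstance, fun P Q hPQ => ?_⟩
  rcases h (Submodule.projection P Q hPQ) with h | h
  · left
    have := Submodule.range_projection hPQ
    rw [← this, h, LinearMap.range_zero]
  · right
    have := Submodule.ker_projection hPQ
    rw [← this, LinearMap.ker_eq_bot.2 h.1]

theorem isEndoregular_of_eq_zero_or_bijective {N : Type*} [AddCommGroup N] [Module K N]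
    (h : ∀ f : N →ₗ[K] N, f = 0 ∨ Function.Bijective f) : IsEndoregular K N := by
  intro f
  rcases h f with rfl | hf
  · exact ⟨0, by simp⟩
  · obtain ⟨u, rfl⟩ := (Module.End.isUnit_iff f).2 hf
    exact ⟨↑u⁻¹, by simp⟩

theorem HasTriangularEnd.hasRickartDecomposition (hℓ : ∀ i, 0 < ℓ i)
    (hT : HasTriangularEnd K M ℓ) : HasRickartDecomposition K M ℓ := by
  obtain ⟨D, _, T, Φ, hann⟩ := hT
  -- Positivity of `ℓ i` provides a matrix unit in every block; its image `LinearMap.range (ε i)`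
  -- plays the role of `H i`.
  let z : ∀ i, Fin (ℓ i) := fun i => ⟨0, hℓ i⟩
  let ε : ∀ i, Module.End K M := fun i => Φ (T.unit i (z i) (z i) 1)
  have hε : ∀ i, ε i * ε i = ε i := fun i => by
    simp only [ε, ← map_mul, T.unit_mul_unit, mul_one]
  have hfix : ∀ i (x : LinearMap.range (ε i)), ε i x = x := by
    rintro i ⟨_, x, rfl⟩
    exact LinearMap.congr_fun (hε i) x
  -- A map between images extends to `M` by first applying `ε j`. By `hcorner` below, this
  -- identifies it with an element of the corner `ε i * S * ε j`, which has a single entry, in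
  -- position `(i, j)`.
  let lift : ∀ {i j}, (LinearMap.range (ε j) →ₗ[K] LinearMap.range (ε i)) → Module.End K M :=
    fun {i j} f => (LinearMap.range (ε i)).subtype ∘ₗ f ∘ₗ (ε j).rangeRestrict
  have hrestr : ∀ j (x : LinearMap.range (ε j)), (ε j).rangeRestrict x = x := fun j x =>
    Subtype.ext (hfix j x)
  have hlift : ∀ {i j} (f : LinearMap.range (ε j) →ₗ[K] LinearMap.range (ε i))
      (x : LinearMap.range (ε j)), lift f x = f x := fun {i j} f x => by
    simp only [lift, LinearMap.comp_apply, hrestr, Submodule.subtype_apply]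
  have hcorner : ∀ {i j} (f : LinearMap.range (ε j) →ₗ[K] LinearMap.range (ε i)),
      T.unit i (z i) (z i) 1 * Φ.symm (lift f) * T.unit j (z j) (z j) 1 = Φ.symm (lift f) := by
    intro i j f
    apply Φ.injective
    rw [map_mul, map_mul, Φ.apply_symm_apply]
    ext x
    change ε i (lift f (ε j x)) = lift f x
    have h1 : lift f (ε j x) = f ((ε j).rangeRestrict x) := hlift f ((ε j).rangeRestrict x)
    rw [h1, hfix]
    rfl
  have hlift0 : ∀ {i j} (f : LinearMap.range (ε j) →ₗ[K] LinearMap.range (ε i)),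
      lift f = 0 → f = 0 := fun {i j} f hf => by
    ext x
    rw [← hlift, hf]; rfl
  have hlt : ∀ i j, i < j →
      MapsZeroOrInjective K (LinearMap.range (ε j)) (LinearMap.range (ε i)) := by
    intro i j hij f
    by_cases hf : Function.Injective f
    · exact .inr hf
    left
    rw [← LinearMap.ker_eq_bot, Submodule.eq_bot_iff] at hf
    push Not at hf
    obtain ⟨x, hx, hx0⟩ := hf
    apply hlift0
    have ht := hcorner f
    rw [TriangularData.unit, TriangularData.unit, T.single_mul_mul_single] at ht
    have hs : lift f * ε j = lift f := by
      refine LinearMap.ext fun y => ?_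
      exact hlift f ((ε j).rangeRestrict y)
    -- The element of `V i j` fed to the annihilator condition is the `(i, j)` entry of `lift f`,
    -- read off from `ht`.
    have := hann i j hij (z j) x x.2 (by simpa using hx0) _ (by
      rw [ht, Φ.apply_symm_apply]
      change (lift f * ε j) x = 0
      rw [hs, hlift, hx]; rfl)
    rw [ht, Φ.apply_symm_apply] at this
    rw [← hs]; exact this
  have hgt : ∀ i j, j < i → ∀ f : LinearMap.range (ε j) →ₗ[K] LinearMap.range (ε i), f = 0 := by
    intro i j hij f
    apply hlift0
    have ht := hcorner f
    rw [TriangularData.unit, TriangularData.unit, T.single_mul_mul_single,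
      T.lower_eq_zero i j hij (T.mul _ _), T.single_zero] at ht
    simpa using ht.symm
  have heq : ∀ i (f : LinearMap.range (ε i) →ₗ[K] LinearMap.range (ε i)),
      f = 0 ∨ Function.Bijective f := by
    intro i f
    obtain ⟨d, hd⟩ := T.exists_eq_unit_of_unit_mul_mul_unit (hcorner f)
    have hf : lift f = Φ (T.unit i (z i) (z i) d) := by rw [← hd, Φ.apply_symm_apply]
    rcases eq_or_ne d 0 with rfl | hd0
    · left
      apply hlift0
      rw [hf, TriangularData.unit, Matrix.single_zero, map_zero, T.single_zero, map_zero]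
    right
    have h1 : Φ (T.unit i (z i) (z i) d⁻¹) * lift f = ε i := by
      rw [hf, ← map_mul, T.unit_mul_unit, inv_mul_cancel₀ hd0]
    have h2 : lift f * Φ (T.unit i (z i) (z i) d⁻¹) = ε i := by
      rw [hf, ← map_mul, T.unit_mul_unit, mul_inv_cancel₀ hd0]
    constructor
    · rw [← LinearMap.ker_eq_bot, Submodule.eq_bot_iff]
      intro x hx
      have h3 := LinearMap.congr_fun h1 (x : M)
      rw [hfix, Module.End.mul_apply, hlift, LinearMap.mem_ker.1 hx] at h3
      exact Subtype.ext (by simpa using h3.symm)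
    · intro x
      refine ⟨(ε i).rangeRestrict (Φ (T.unit i (z i) (z i) d⁻¹) x), ?_⟩
      apply Subtype.ext
      have h3 := LinearMap.congr_fun h2 (x : M)
      rw [hfix] at h3
      exact h3
  have hnt : ∀ i, Nontrivial (LinearMap.range (ε i)) := fun i => by
    rw [Submodule.nontrivial_iff_ne_bot, Ne, LinearMap.range_eq_bot]
    intro h0
    exact T.unit_one_ne_zero i (z i) (z i) (Φ.injective (h0.trans (map_zero Φ).symm))
  have hne : ∀ i j, i < j → IsEmpty (LinearMap.range (ε i) ≃ₗ[K] LinearMap.range (ε j)) := by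
    intro i j hij
    refine ⟨fun e => ?_⟩
    obtain ⟨x, y, hxy⟩ := exists_pair_ne (LinearMap.range (ε i))
    -- For `i < j` an isomorphism from the `i`-th to the `j`-th image would be a corner element
    -- below the diagonal, hence zero on a nonzero module.
    have h0 := hgt j i hij e.toLinearMap
    apply hxy
    apply e.injective
    exact (LinearMap.congr_fun h0 x).trans (LinearMap.congr_fun h0 y).symm
  refine ⟨fun i => LinearMap.range (ε i), inferInstance, inferInstance,
    ⟨fun i => isIndecomposableModule_of_eq_zero_or_bijective (heq i),
      fun i => isEndoregular_of_eq_zero_or_bijective (heq i), fun j i => ?_, fun i j hij => ?_⟩, ?_⟩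
  · apply MapsZeroOrInjective.isRelRickart
    rcases lt_trichotomy i j with h | rfl | h
    · exact hlt i j h
    · exact fun f => (heq i f).imp id (·.1)
    · exact fun f => .inl (hgt i j h f)
  · rcases lt_or_gt_of_ne hij with h | h
    · exact hne i j h
    · exact ⟨fun e => (hne j i h).false e.symm⟩
  have hmem : ∀ i k x, Φ (T.unit i (z i) k 1) x ∈ LinearMap.range (ε i) := fun i k x =>
    ⟨Φ (T.unit i (z i) k 1) x, by
      rw [← Module.End.mul_apply, ← map_mul, T.unit_mul_unit, one_mul]⟩
  -- The matrix unit `E_{zk}` carries the `k`-th copy in block `i` onto the range of `ε i`, and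
  -- `E_{kz}` carries it back. The two composites reduce to the matrix unit relations and to the
  -- diagonal units summing to `1`.
  refine ⟨LinearEquiv.ofLinearMap
    (LinearMap.pi fun i => LinearMap.pi fun k =>
      (Φ (T.unit i (z i) k 1)).codRestrict (LinearMap.range (ε i)) (hmem i k))
    (∑ i, ∑ k, Φ (T.unit i k (z i) 1) ∘ₗ (LinearMap.range (ε i)).subtype ∘ₗ
      LinearMap.proj k ∘ₗ LinearMap.proj (φ := fun i => Fin (ℓ i) → LinearMap.range (ε i)) i)
    ?_ ?_⟩
  · refine LinearMap.ext fun y => funext fun i => funext fun k => Subtype.ext ?_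
    simp only [LinearMap.comp_apply, LinearMap.sum_apply, LinearMap.pi_apply, map_sum,
      LinearMap.proj_apply, Submodule.subtype_apply, LinearMap.id_apply,
      LinearMap.codRestrict_apply, AddSubmonoidClass.coe_finsetSum]
    simp only [← Module.End.mul_apply, ← map_mul]
    rw [Finset.sum_eq_single i, Finset.sum_eq_single k]
    · rw [T.unit_mul_unit, one_mul]
      exact hfix i (y i k)
    · intro l _ hl
      rw [T.unit_mul_unit_of_ne i hl.symm, map_zero, LinearMap.zero_apply]
    · simp
    · intro j _ hj
      refine Finset.sum_eq_zero fun l _ => ?_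
      rw [T.unit_mul_unit_of_block_ne hj.symm, map_zero, LinearMap.zero_apply]
    · simp
  · refine LinearMap.ext fun x => ?_
    simp only [LinearMap.comp_apply, LinearMap.sum_apply, LinearMap.pi_apply,
      LinearMap.proj_apply, Submodule.subtype_apply, LinearMap.id_apply,
      LinearMap.codRestrict_apply]
    simp only [← Module.End.mul_apply, ← map_mul, T.unit_mul_unit, one_mul]
    simp only [← LinearMap.sum_apply, ← map_sum, T.sum_unit_eq_one, map_one]
    rfl

end Converse

/-! ### Relative injectivity and kernels of homomorphisms between direct sums -/

section RelInjective

variable {K : Type u} [Ring K]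

/-- Recasts a complement as a projection onto the kernel, which is easy to transport along
equivalences and to build explicitly. -/
theorem isComplemented_ker_iff {N : Type*} [AddCommGroup N] [Module K N] {P : Type*}
    [AddCommGroup P] [Module K P] (f : N →ₗ[K] P) :
    IsComplemented (LinearMap.ker f) ↔
      ∃ p : N →ₗ[K] N, (∀ x, f (p x) = 0) ∧ ∀ x, f x = 0 → p x = x := by
  constructor
  · rintro ⟨C, hC⟩
    refine ⟨Submodule.projection _ C hC, fun x => ?_, fun x hx => ?_⟩
    · exact (Submodule.range_projection hC).le (LinearMap.mem_range_self _ x)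
    · exact Submodule.projection_apply_left hC ⟨x, hx⟩
  · rintro ⟨p, hp, hp'⟩
    exact ⟨LinearMap.ker p, LinearMap.IsProj.isCompl (f := p) ⟨fun x => hp x, fun x hx => hp' x hx⟩⟩

theorem IsRelInjective.congr {A : Type*} [AddCommGroup A] [Module K A] {N N' : Type*}
    [AddCommGroup N] [Module K N] [AddCommGroup N'] [Module K N'] (h : IsRelInjective K A N)
    (e : N ≃ₗ[K] N') : IsRelInjective K A N' := by
  intro L f
  obtain ⟨g, hg⟩ := h (L.comap e.toLinearMap)
    (f ∘ₗ e.toLinearMap.restrict (p := L.comap e.toLinearMap) (q := L) fun x hx => hx)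
  refine ⟨g ∘ₗ e.symm.toLinearMap, fun x => ?_⟩
  have := hg ⟨e.symm x, by simp⟩
  simp only [LinearMap.comp_apply, LinearEquiv.coe_coe]
  rw [this, LinearMap.comp_apply]
  congr 1
  ext
  simp

/-- Extend `f` from the part of `L` inside `N` to a map `g` on `N`. The difference `f - g ∘ fst`
kills the kernel of the projection `L → N'`, so it factors through the image of `L` in `N'` and
extends from there. -/
theorem IsRelInjective.prod {A : Type*} [AddCommGroup A] [Module K A] {N N' : Type*}
    [AddCommGroup N] [Module K N] [AddCommGroup N'] [Module K N'] (h : IsRelInjective K A N)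
    (h' : IsRelInjective K A N') : IsRelInjective K A (N × N') := by
  intro L f
  obtain ⟨g, hg⟩ := h (L.comap (LinearMap.inl K N N'))
    (f ∘ₗ (LinearMap.inl K N N').restrict (p := L.comap (LinearMap.inl K N N')) (q := L)
      fun x hx => hx)
  let f' : L →ₗ[K] A := f - g ∘ₗ LinearMap.fst K N N' ∘ₗ L.subtype
  let q : L →ₗ[K] N' := LinearMap.snd K N N' ∘ₗ L.subtype
  have hker : LinearMap.ker q ≤ LinearMap.ker f' := by
    rintro ⟨⟨x, y⟩, hxy⟩ hy
    obtain rfl : y = 0 := hy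
    have := hg ⟨x, hxy⟩
    rw [LinearMap.mem_ker]
    simp only [f', LinearMap.sub_apply, LinearMap.comp_apply, Submodule.subtype_apply,
      LinearMap.fst_apply, this, sub_eq_zero]
    rfl
  obtain ⟨g', hg'⟩ := h' (LinearMap.range q)
    ((LinearMap.ker q).liftQ f' hker ∘ₗ q.quotKerEquivRange.symm.toLinearMap)
  refine ⟨LinearMap.coprod g g', fun x => ?_⟩
  have h1 := hg' ⟨q x, x, rfl⟩
  have h2 : q.quotKerEquivRange.symm ⟨q x, x, rfl⟩ = (LinearMap.ker q).mkQ x := by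
    rw [LinearEquiv.symm_apply_eq]
    rfl
  simp only [LinearMap.comp_apply, LinearEquiv.coe_coe, h2] at h1
  have h3 : g' (x : N × N').2 = f x - g (x : N × N').1 := h1
  rw [LinearMap.coprod_apply, h3]
  abel

theorem IsRelInjective.pi {A : Type*} [AddCommGroup A] [Module K A] {m : ℕ} {N : Fin m → Type v}
    [∀ i, AddCommGroup (N i)] [∀ i, Module K (N i)] (h : ∀ i, IsRelInjective K A (N i)) :
    IsRelInjective K A (∀ i, N i) := by
  induction m with
  | zero =>
    intro L f
    refine ⟨0, fun x => ?_⟩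
    rw [Subsingleton.elim x 0, map_zero]
    rfl
  | succ m ih =>
    exact ((h 0).prod (ih fun i => h i.succ)).congr (Fin.consLinearEquiv K N)

/-- Induction on the number of summands, writing `f` as `f₁ + f₂` on `G 0` and the rest. If `f₁ =
0`, the kernel is `G 0 × ker f₂`. If `f₁` is injective, the partial map `f₁⁻¹ f₂` extends to `g` by
relative injectivity, and the kernel is the graph of `-g` over `ker (f₂ - f₁ ∘ g)`, to which the
induction hypothesis applies. -/
theorem isComplemented_ker_of_isRelInjective {m : ℕ} {G : Fin m → Type v}
    [∀ i, AddCommGroup (G i)] [∀ i, Module K (G i)] {P : Type*} [AddCommGroup P] [Module K P]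
    (hG : ∀ i j, i < j → IsRelInjective K (G i) (G j))
    (hP : ∀ i, MapsZeroOrInjective K (G i) P) (f : (∀ i, G i) →ₗ[K] P) :
    IsComplemented (LinearMap.ker f) := by
  induction m with
  | zero =>
    rw [isComplemented_ker_iff]
    exact ⟨0, fun x => by simp, fun x _ => Subsingleton.elim _ _⟩
  | succ m ih =>
    have ih' := ih (G := fun i => G i.succ)
      (fun i j hij => hG _ _ (Fin.succ_lt_succ_iff.2 hij)) (fun i => hP i.succ)
    simp only [isComplemented_ker_iff] at ih' ⊢
    let e := Fin.consLinearEquiv K G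
    suffices h : ∃ p : (G 0 × ∀ i : Fin m, G i.succ) →ₗ[K] (G 0 × ∀ i : Fin m, G i.succ),
        (∀ x, f (e (p x)) = 0) ∧ ∀ x, f (e x) = 0 → p x = x by
      obtain ⟨p, hp, hp'⟩ := h
      refine ⟨e.toLinearMap ∘ₗ p ∘ₗ e.symm.toLinearMap, fun x => hp _, fun x hx => ?_⟩
      have := hp' (e.symm x) (by simpa using hx)
      simp [this]
    let f₁ : G 0 →ₗ[K] P := f ∘ₗ e.toLinearMap ∘ₗ LinearMap.inl K _ _
    let f₂ : (∀ i : Fin m, G i.succ) →ₗ[K] P := f ∘ₗ e.toLinearMap ∘ₗ LinearMap.inr K _ _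
    have hf : ∀ a b, f (e (a, b)) = f₁ a + f₂ b := fun a b => by
      simp only [f₁, f₂, LinearMap.comp_apply, LinearEquiv.coe_coe, ← map_add]
      simp
    rcases hP 0 f₁ with h0 | hinj
    · obtain ⟨p, hp, hp'⟩ := ih' f₂
      refine ⟨LinearMap.prodMap LinearMap.id p, fun x => ?_, fun x hx => ?_⟩
      · obtain ⟨a, b⟩ := x
        simp [hf, h0, hp]
      · obtain ⟨a, b⟩ := x
        rw [hf, h0, LinearMap.zero_apply, zero_add] at hx
        simp [hp' b hx]
    · obtain ⟨g, hg⟩ := IsRelInjective.pi (fun i : Fin m => hG 0 i.succ (Fin.succ_pos i))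
        ((LinearMap.range f₁).comap f₂)
        ((LinearEquiv.ofInjective f₁ hinj).symm.toLinearMap ∘ₗ
          f₂.restrict (p := (LinearMap.range f₁).comap f₂) (q := LinearMap.range f₁)
            fun x hx => hx)
      have hg' : ∀ a b, f₁ a = f₂ b → g b = a := fun a b hab => by
        rw [hg ⟨b, a, hab⟩, LinearMap.comp_apply, LinearEquiv.coe_coe, LinearEquiv.symm_apply_eq]
        exact Subtype.ext hab.symm
      obtain ⟨p, hp, hp'⟩ := ih' (f₂ - f₁ ∘ₗ g)
      -- The projection onto that graph: discard the `G 0` coordinate, project the rest by `p`, and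
      -- recover the first coordinate as `-g`.
      refine ⟨LinearMap.prod (-(g ∘ₗ p)) p ∘ₗ LinearMap.snd K _ _, fun x => ?_, fun x hx => ?_⟩
      · have := hp x.2
        simp only [LinearMap.sub_apply, LinearMap.comp_apply] at this
        refine (hf _ _).trans ?_
        simp only [LinearMap.neg_apply, LinearMap.comp_apply, LinearMap.snd_apply, map_neg]
        rw [← this]
        abel
      · obtain ⟨a, b⟩ := x
        rw [hf] at hx
        have hab : g b = -a := hg' _ _ (by rw [map_neg]; exact neg_eq_of_add_eq_zero_right hx)
        have hb : p b = b := hp' b (by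
          change f₂ b - f₁ (g b) = 0
          rw [hab, map_neg, sub_neg_eq_add, add_comm]
          exact hx)
        simp [hb, hab]

theorem isRickart_of_isRelInjective {m : ℕ} {G : Fin m → Type v} [∀ i, AddCommGroup (G i)]
    [∀ i, Module K (G i)] (hG : ∀ i j, i < j → IsRelInjective K (G i) (G j))
    (hG' : ∀ i j, MapsZeroOrInjective K (G i) (G j)) {M : Type*} [AddCommGroup M] [Module K M]
    (e : M ≃ₗ[K] ∀ i, G i) : IsRickart K M := by
  intro f
  have h := isComplemented_ker_of_isRelInjective (P := M) hG
    (fun i => (MapsZeroOrInjective.pi (hG' i)).congr_right e) (f ∘ₗ e.symm.toLinearMap)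
  rw [isComplemented_ker_iff] at h ⊢
  obtain ⟨p, hp, hp'⟩ := h
  refine ⟨e.symm.toLinearMap ∘ₗ p ∘ₗ e.toLinearMap, fun x => hp _, fun x hx => ?_⟩
  have := hp' (e x) (by simpa using hx)
  simp [this]

end RelInjective

/-! ### The corollary's triangular form and the final assembly -/

theorem IsRickartFamily.exists_triangularData {K : Type u} [Ring K] {n : ℕ} {H : Fin n → Type v}
    [∀ i, AddCommGroup (H i)] [∀ i, Module K (H i)] (hH : IsRickartFamily K H) {M : Type v}
    [AddCommGroup M] [Module K M] (e : M ≃ₗ[K] ∀ i, H i) :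
    ∃ (D : Fin n → Type v) (_ : ∀ i, DivisionRing (D i)) (T : TriangularData D),
      Nonempty (T.Mat ≃+* Module.End K M) := by
  obtain ⟨σ, hσ⟩ := hH.exists_perm
  exact ⟨fun i => Module.End K (H (σ i)), fun i => hH.divisionRing (σ i),
    TriangularData.ofHom (fun i => H (σ i)) (fun i => RingEquiv.refl _) hσ,
    ⟨(TriangularData.ofHomEquiv _ _ hσ).trans
      (e.trans (LinearEquiv.piCongrLeft K H σ).symm).symm.conjRingEquiv⟩⟩

theorem mainTheorem9 {R : Type u} [Ring R] {M : Type v} [AddCommGroup M] [Module Rᵐᵒᵖ M] :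
    -- the equivalence of (a) and (b)
    (∀ (n : ℕ) (ℓ : Fin n → ℕ), (∀ i, 0 < ℓ i) →
      (HasRickartDecomposition Rᵐᵒᵖ M ℓ ↔
        ∃ σ : Equiv.Perm (Fin n), HasTriangularEnd Rᵐᵒᵖ M (ℓ ∘ σ))) ∧
    -- in this case the endomorphism ring is a semiprimary piecewise domain
    (∀ (n : ℕ) (ℓ : Fin n → ℕ), (∀ i, 0 < ℓ i) → HasRickartDecomposition Rᵐᵒᵖ M ℓ →
      IsSemiprimaryRing (Module.End Rᵐᵒᵖ M) ∧ IsPiecewiseDomain (Module.End Rᵐᵒᵖ M)) ∧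
    -- the addition under relative injectivity hypotheses
    (∀ (n : ℕ) (H : Fin n → Type v) [∀ i, AddCommGroup (H i)] [∀ i, Module Rᵐᵒᵖ (H i)],
      IsRickartFamily Rᵐᵒᵖ H → Nonempty (M ≃ₗ[Rᵐᵒᵖ] (∀ i, H i)) →
      (∃ σ : Equiv.Perm (Fin n), ∀ i j, i < j → IsRelInjective Rᵐᵒᵖ (H (σ i)) (H (σ j))) →
      IsRickart Rᵐᵒᵖ M ∧
        (∃ (D : Fin n → Type v) (_ : ∀ i, DivisionRing (D i)) (T : TriangularData D),
          Nonempty (T.Mat ≃+* Module.End Rᵐᵒᵖ M)) ∧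
        IsSemiprimaryRing (Module.End Rᵐᵒᵖ M) ∧ IsPiecewiseDomain (Module.End Rᵐᵒᵖ M)) := by
  refine ⟨fun n ℓ hℓ => ⟨fun h => h.exists_hasTriangularEnd, ?_⟩,
    fun n ℓ _ h => ⟨h.isSemiprimaryRing, h.isPiecewiseDomain⟩, ?_⟩
  · rintro ⟨σ, h⟩
    -- The converse yields a decomposition with permuted multiplicities; relabelling by the inverse
    -- permutation restores `ℓ`.
    have h1 := (HasTriangularEnd.hasRickartDecomposition (ℓ := ℓ ∘ σ)
      (fun i => hℓ (σ i)) h).comp_perm σ.symm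
    have h2 : (ℓ ∘ σ) ∘ σ.symm = ℓ := by ext i; simp
    rwa [h2] at h1
  · rintro n H _ _ hH ⟨e⟩ ⟨σ, hσ⟩
    -- The order making `S` triangular is chosen independently of the order `σ` for relative
    -- injectivity.
    have hT := hH.exists_triangularData e
    refine ⟨isRickart_of_isRelInjective hσ (fun i j => hH.mapsZeroOrInjective (σ i) (σ j))
      (e.trans (LinearEquiv.piCongrLeft _ H σ).symm), hT, ?_,
      isPiecewiseDomain_of_mapsZeroOrInjective hH.mapsZeroOrInjective e⟩
    obtain ⟨D, _, T, ⟨Φ⟩⟩ := hT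
    exact T.isSemiprimaryRing_of_ringEquiv Φ
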